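/- Let $G$ be a connected (finite-dimensional, real, smooth) Lie group with identity $e$, let $\mathfrak g$ be the Lie algebra of right-invariant vector fields on $G$, with the bracket of vector fields, and let $\exp\colon\mathfrak g\to G$ be the exponential map. Let $\mathcal X$ be a linear vector field on $G$, i.e. a smooth vector field whose flow $(\varphi_t)_{t\in\mathbb R}$ is a one-parameter group of automorphisms of $G$, and let $\mathcal D$ be its associated derivation of $\mathfrak g$, $\mathcal D(Y)=-[\mathcal X,Y]$. Suppose that $\mathcal D$ is inner, i.e. $\mathcal D=-\operatorname{ad}(X)$ for some $X\in\mathfrak g$ (that is, $[\mathcal X,Y]=[X,Y]$ for all $Y\in\mathfrak g$). Then: 1. $\mathcal X=X+dI\,X$, where $dI\,X$ is the left-invariant vector field obtained by pushing $X$ forward under the inversion $I(g)=g^{-1}$, and $\varphi_t(g)=\exp(tX)\,g\,\exp(-tX)$ for all $t\in\mathbb R$ and $g\in G$. 2. Let $Y_1,\dots,Y_m\in\mathfrak g$, let $u\colon\mathbb R\to\mathbb R^m$ be piecewise constant (locally constant off a set of jump times that has finitely many points in each bounded interval), and suppose that $u$ is constant on $[0,T]$, $T\ge 0$, with value $(u_1,\dots,u_m)$.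 Then the curve $$\phi_t(u,e)=\exp\Big(tX+t\sum_{j=1}^m u_jY_j\Big)\exp(-tX),\qquad 0\le t\le T,$$ is on $[0,T]$ the unique solution starting at $e$ at time $0$ of the linear control system $$\frac{dg}{dt}=\mathcal X(g)+\sum_{j=1}^m u_j(t)\,Y_j(g):$$ it is a solution on $[0,T]$, and every solution with control $u$ starting at $e$ at time $0$, on any interval containing $[0,T]$, coincides with it on $[0,T]$. (A solution is a continuous curve which satisfies the equation at all times of its interval of definition $J$ at which the restriction of $u$ to $J$ is locally constant.) In particular, if the Lie algebra of $G$ is semisimple (its solvable radical is zero), then for every linear vector field $\mathcal X$ on $G$ such an $X\in\mathfrak g$ exists, so that 1 and 2 hold. -/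

import Mathlib

open scoped Manifold ContDiff

/-- A smooth real Lie group has the regularity under which its Lie algebra is set up. -/
instance instLieGroupMinSmoothnessThree {E : Type*} [NormedAddCommGroup E] [NormedSpace ℝ E]
    {H : Type*} [TopologicalSpace H] {I : ModelWithCorners ℝ E H}
    {G : Type*} [TopologicalSpace G] [ChartedSpace H G] [Group G] [LieGroup I ∞ G] :
    LieGroup I (minSmoothness ℝ 3) G :=
  LieGroup.of_le (n := ∞) (by
    rw [minSmoothness_of_isRCLikeNormedField]
    exact ENat.LEInfty.out)

noncomputable section

namespace LinearControl

variable {E : Type*} [NormedAddCommGroup E] [NormedSpace ℝ E]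
  {H : Type*} [TopologicalSpace H] {I : ModelWithCorners ℝ E H}
  {G : Type*} [TopologicalSpace G] [ChartedSpace H G] [Group G]

/-- The right-invariant vector field `g ↦ d(R_g)_e v` with value `v` at the identity. Through
`v ↦ rightInvariant v` the space `GroupLieAlgebra I G` (the tangent space at the identity) is
identified with the space `𝔤` of right-invariant vector fields. -/
def rightInvariant (v : GroupLieAlgebra I G) (g : G) : TangentSpace I g :=
  mfderiv I I (fun x : G => x * g) (1 : G) v

/-- The vector field `dI V` induced from `V` by the inversion map `x ↦ x⁻¹`, that is, the
push-forward `g ↦ d(inv)_{g⁻¹} (V (g⁻¹))`. -/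
def inversionField (V : (g : G) → TangentSpace I g) (g : G) : TangentSpace I g :=
  mfderiv I I (fun x : G => x⁻¹) g⁻¹ (V g⁻¹)

/-- The exponential map of the Lie group: `lieExp v = γ 1`, where `γ : ℝ → G` is the integral curve
with `γ 0 = 1` of the right-invariant vector field determined by `v`. -/
def lieExp (v : GroupLieAlgebra I G) : G :=
  (Classical.epsilon fun γ : ℝ → G => γ 0 = 1 ∧ IsMIntegralCurve γ (rightInvariant v)) 1

/-- `φ` is the (global) flow of the vector field `V`. -/
structure IsFlow (V : (g : G) → TangentSpace I g) (φ : ℝ → G → G) : Prop where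
  map_zero : ∀ g, φ 0 g = g
  isMIntegralCurve : ∀ g, IsMIntegralCurve (fun t => φ t g) V

/-- A smooth vector field is linear if its flow is a one-parameter group of automorphisms of the
Lie group. -/
structure IsLinearVectorField [LieGroup I ∞ G] (V : (g : G) → TangentSpace I g) : Prop where
  smooth : ContMDiff I I.tangent ∞ (fun g => (⟨g, V g⟩ : TangentBundle I G))
  exists_flow : ∃ φ : ℝ → G ≃* G, IsFlow V (fun t => φ t) ∧
    (∀ s t, φ (s + t) = (φ t).trans (φ s)) ∧ ∀ t, ContMDiff I I ∞ (φ t)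

/-- The derivation `D` of `𝔤` associated to a linear vector field `V`: `D Y = -[V, Y]`, the bracket
being that of vector fields on the group. -/
def derivationOf (V : (g : G) → TangentSpace I g) (Y : GroupLieAlgebra I G) :
    (g : G) → TangentSpace I g :=
  -VectorField.mlieBracket I V (rightInvariant Y)

/-- The derivation `D` associated to `V` is inner, given by `X`: `D = -ad X` on the Lie algebra `𝔤`
of right-invariant vector fields, i.e. `D Y = -[X, Y]` for all `Y` in `𝔤`. -/
def IsInnerBy (V : (g : G) → TangentSpace I g) (X : GroupLieAlgebra I G) : Prop :=
  ∀ Y : GroupLieAlgebra I G,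
    derivationOf V Y = -VectorField.mlieBracket I (rightInvariant X) (rightInvariant Y)

/-- Admissible controls: piecewise constant functions on the line, i.e. functions that are locally
constant off a set of jump times having finitely many points in every bounded interval. -/
def IsPiecewiseConstant {m : ℕ} (u : ℝ → Fin m → ℝ) : Prop :=
  ∃ S : Set ℝ, (∀ a b : ℝ, (S ∩ Set.Icc a b).Finite) ∧
    ∀ t ∉ S, ∀ᶠ τ in nhds t, u τ = u t

/-- `γ` is, on the time interval `J`, a solution of the control system
`dg/dt = V(g) + ∑ j, u j (t) • Y j (g)` for the piecewise constant control `u`, starting at `g₀`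
at time `0`: it is continuous on `J` and satisfies the equation at all times of `J` other than the
jump times of the restriction of `u` to `J` (one-sidedly at end points of `J` that belong to `J`). -/
structure IsSolutionOn {m : ℕ} (V : (g : G) → TangentSpace I g)
    (Y : Fin m → GroupLieAlgebra I G) (u : ℝ → Fin m → ℝ) (g₀ : G) (γ : ℝ → G) (J : Set ℝ) :
    Prop where
  initial : γ 0 = g₀
  continuousOn : ContinuousOn γ J
  equation : ∀ t ∈ J, (∀ᶠ τ in nhdsWithin t J, u τ = u t) →
    HasMFDerivWithinAt 𝓘(ℝ, ℝ) I γ J t ((1 : ℝ →L[ℝ] ℝ).smulRight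
      (V (γ t) + ∑ j, u t j • rightInvariant (Y j) (γ t)))

end LinearControl

end

/-
A vector field commuting with every right-invariant field is left-invariant: its expression in the
left trivialization of the tangent bundle has zero differential, because left- and right-invariant
fields commute. Since a linear field vanishes at the identity, an inner derivation `-ad X` forces
`𝒳 = R_X + L_{-X}`, where `R` and `L` denote right- and left-invariant fields. The integral curves
of `R_A + L_B` are the curves `t ↦ exp (tA) g exp (tB)`; this gives the flow with `A = X`, and the
solution for a constant control with `A = X + ∑ j, u j • Y j`, both with `B = -X`. In the semisimple
case, `Y ↦ [𝒳, Y]` is a derivation of a Lie algebra with nondegenerate Killing form, hence inner.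
-/

namespace LinearControl

open VectorField Set Filter Topology Bundle

section Manifold

variable {E : Type*} [NormedAddCommGroup E] [NormedSpace ℝ E]
  {H : Type*} [TopologicalSpace H] {I : ModelWithCorners ℝ E H}
  {M : Type*} [TopologicalSpace M] [ChartedSpace H M]
  {E' : Type*} [NormedAddCommGroup E'] [NormedSpace ℝ E']
  {H' : Type*} [TopologicalSpace H'] {I' : ModelWithCorners ℝ E' H'}
  {N : Type*} [TopologicalSpace N] [ChartedSpace H' N]

lemma velocity_unique {γ : ℝ → M} {t : ℝ} {v w : TangentSpace I (γ t)}
    (hv : HasMFDerivAt 𝓘(ℝ, ℝ) I γ t ((1 : ℝ →L[ℝ] ℝ).smulRight v))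
    (hw : HasMFDerivAt 𝓘(ℝ, ℝ) I γ t ((1 : ℝ →L[ℝ] ℝ).smulRight w)) : v = w := by
  have h := congrArg (fun D : ℝ →L[ℝ] E ↦ D 1) (hasMFDerivAt_unique hv hw)
  exact (one_smul ℝ (v : E)).symm.trans (h.trans (one_smul ℝ (w : E)))

lemma hasMFDerivAt_comp_curve {f : M → N} {γ : ℝ → M} {t : ℝ} {v : TangentSpace I (γ t)}
    (hf : MDifferentiableAt I I' f (γ t))
    (hγ : HasMFDerivAt 𝓘(ℝ, ℝ) I γ t ((1 : ℝ →L[ℝ] ℝ).smulRight v)) :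
    HasMFDerivAt 𝓘(ℝ, ℝ) I' (fun s ↦ f (γ s)) t
      ((1 : ℝ →L[ℝ] ℝ).smulRight (mfderiv I I' f (γ t) v)) := by
  refine (hf.hasMFDerivAt.comp t hγ).congr_mfderiv ?_
  ext
  exact (mfderiv I I' f (γ t)).map_smul (1 : ℝ) v

lemma mlieBracket_eq_zero_of_eventually_zero_along_curve [CompleteSpace E] [IsManifold I 2 M]
    {V W : (x : M) → TangentSpace I x} {γ : ℝ → M} {t : ℝ}
    (hγ : HasMFDerivAt 𝓘(ℝ, ℝ) I γ t ((1 : ℝ →L[ℝ] ℝ).smulRight (V (γ t))))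
    (hW : MDifferentiableAt I I.tangent (fun x ↦ (⟨x, W x⟩ : TangentBundle I M)) (γ t))
    (hWγ : ∀ᶠ s in 𝓝 t, W (γ s) = 0) : mlieBracket I V W (γ t) = 0 := by
  let χ := extChartAt I (γ t)
  let c : ℝ → E := χ ∘ γ
  let s : Set E := χ.symm ⁻¹' univ ∩ range I
  let pullV : E → E := mpullbackWithin 𝓘(ℝ, E) I χ.symm V (range I)
  let pullW : E → E := mpullbackWithin 𝓘(ℝ, E) I χ.symm W (range I)
  have hγs : ∀ᶠ τ in 𝓝 t, γ τ ∈ χ.source :=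
    hγ.continuousAt.eventually (extChartAt_source_mem_nhds (I := I) (γ t))
  have hc : HasDerivAt c (pullV (c t)) t := by
    have h := hasMFDerivAt_comp_curve (I' := 𝓘(ℝ, E)) (f := χ)
      (mdifferentiableAt_extChartAt (mem_chart_source H (γ t))) hγ
    rw [mfderiv_extChartAt_self (I := I)] at h
    have hpull : pullV (c t) = V (γ t) := by
      have hV : (V (χ.symm (χ (γ t))) : E) = V (γ t) := by rw [extChartAt_to_inv]
      exact (mfderivWithin_extChartAt_symm_inverse_apply (I := I) (x := γ t) _).trans hV
    rw [hpull]
    have h' : HasFDerivAt c ((1 : ℝ →L[ℝ] ℝ).smulRight (V (γ t) : E)) t := h.hasFDerivAt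
    exact h'.hasDerivAt.congr_deriv (one_smul ℝ _)
  have hcW : ∀ᶠ τ in 𝓝 t, pullW (c τ) = 0 := by
    filter_upwards [hγs, hWγ] with τ hτ hWτ
    have hW' : (W (χ.symm (χ (γ τ))) : E) = 0 := by rw [χ.left_inv hτ]; exact hWτ
    exact (congrArg (mfderiv[range I] χ.symm (c τ)).inverse hW').trans (map_zero _)
  have hWt : pullW (c t) = 0 := hcW.self_of_nhds
  have hderiv : fderivWithin ℝ pullW s (c t) (pullV (c t)) = 0 := by
    have hpullW : DifferentiableWithinAt ℝ pullW s (c t) :=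
      hW.mdifferentiableWithinAt.differentiableWithinAt_mpullbackWithin_vectorField
    have h := hpullW.hasFDerivWithinAt.comp_hasDerivAt t hc
      (Eventually.of_forall fun τ ↦ ⟨mem_univ _, mem_range_self _⟩)
    exact h.unique ((hasDerivAt_const t (0 : E)).congr_of_eventuallyEq hcW)
  rw [← mlieBracketWithin_univ, mlieBracketWithin_apply]
  refine (congrArg _ ?_).trans (map_zero _)
  change fderivWithin ℝ pullW s (c t) (pullV (c t)) - fderivWithin ℝ pullV s (c t) (pullW (c t)) = 0
  rw [hderiv, hWt, map_zero, sub_zero]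

lemma mfderiv_mlieBracket_of_related [CompleteSpace E] [CompleteSpace E'] [IsManifold I ∞ M]
    [IsManifold I' ∞ N] (f : M ≃ₘ⟮I, I'⟯ N) {V W : (x : M) → TangentSpace I x}
    {V' W' : (y : N) → TangentSpace I' y} (hV : ∀ x, mfderiv I I' f x (V x) = V' (f x))
    (hW : ∀ x, mfderiv I I' f x (W x) = W' (f x)) (hV' : MDiff (T% V')) (hW' : MDiff (T% W'))
    (x : M) : mfderiv I I' f x (mlieBracket I V W x) = mlieBracket I' V' W' (f x) := by
  have hf (x : M) : (mfderiv I I' f x).IsInvertible :=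
    ⟨f.mfderivToContinuousLinearEquiv (by simp) x, rfl⟩
  have mpullback_eq {U : (x : M) → TangentSpace I x} {U' : (y : N) → TangentSpace I' y}
      (hU : ∀ x, mfderiv I I' f x (U x) = U' (f x)) : mpullback I I' f U' = U := by
    ext x
    rw [mpullback_apply, ← hU, (hf x).inverse_apply_eq]
  have hle : minSmoothness ℝ 3 ≤ ∞ := by simpa using ENat.LEInfty.out
  have : IsManifold I (minSmoothness ℝ 3) M := IsManifold.of_le hle
  have : IsManifold I' (minSmoothness ℝ 3) N := IsManifold.of_le hle
  have h := mpullback_mlieBracket (x₀ := x) (hV' (f x)) (hW' (f x)) f.contMDiff.contMDiffAt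
    (by simpa using ENat.LEInfty.out)
  rw [mpullback_eq hV, mpullback_eq hW, mpullback_apply, (hf x).inverse_apply_eq] at h
  exact h.symm

lemma mlieBracket_sum_smul_right [CompleteSpace E] [IsManifold I 2 M] {ι : Type*} (s : Finset ι)
    {V : (x : M) → TangentSpace I x} {f : ι → M → ℝ} {W : ι → (x : M) → TangentSpace I x} {x : M}
    (hf : ∀ i ∈ s, MDiffAt (f i) x) (hW : ∀ i ∈ s, MDiffAt (T% (W i)) x) :
    mlieBracket I V (∑ i ∈ s, f i • W i) x =
      ∑ i ∈ s, (mvfderiv I (f i) x (V x) • W i x + f i x • mlieBracket I V (W i) x) := by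
  classical
  induction s using Finset.induction_on with
  | empty => simp
  | insert i s hi ih =>
    rw [Finset.forall_mem_insert] at hf hW
    have hsum : MDiffAt (T% (∑ i ∈ s, f i • W i)) x := by
      simpa using MDifferentiableAt.sum_section (t := fun i ↦ f i • W i)
        fun i hi ↦ (hf.2 i hi).smul_section (hW.2 i hi)
    rw [Finset.sum_insert hi, Finset.sum_insert hi,
      mlieBracket_add_right (hf.1.smul_section hW.1) hsum, ih hf.2 hW.2,
      mlieBracket_smul_right hf.1 hW.1]

lemma mvfderiv_clm_comp_apply {F F' : Type*} [NormedAddCommGroup F] [NormedSpace ℝ F]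
    [NormedAddCommGroup F'] [NormedSpace ℝ F'] (L : F →L[ℝ] F') {f : M → F} {x : M}
    (hf : MDifferentiableAt I 𝓘(ℝ, F) f x) (v : TangentSpace I x) :
    mvfderiv I (L ∘ f) x v = L (mvfderiv I f x v) :=
  (mfderiv_comp_apply x L.mdifferentiableAt hf v).trans
    (congrArg (fun D : F →L[ℝ] F' ↦ D _) L.mfderiv_eq)

lemma isLocallyConstant_of_mvfderiv_eq_zero [I.Boundaryless] [IsManifold I 1 M] {F : Type*}
    [NormedAddCommGroup F] [NormedSpace ℝ F] {f : M → F} (hf : MDiff f)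
    (hf' : ∀ x, mvfderiv I f x = 0) : IsLocallyConstant f := by
  refine (IsLocallyConstant.iff_eventually_eq f).2 fun x ↦ ?_
  let χ := extChartAt I x
  obtain ⟨ε, hε, hball⟩ := Metric.isOpen_iff.1 (isOpen_extChartAt_target (I := I) x) _
    (mem_extChartAt_target x)
  have hderiv : ∀ y ∈ Metric.ball (χ x) ε, HasFDerivAt (f ∘ χ.symm) (0 : E →L[ℝ] F) y := by
    intro y hy
    have hχ : MDifferentiableAt 𝓘(ℝ, E) I χ.symm y :=
      (mdifferentiableWithinAt_extChartAt_symm (hball hy)).mdifferentiableAt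
        (by simp [I.range_eq_univ])
    refine ((hf _).hasMFDerivAt.comp y hχ.hasMFDerivAt).hasFDerivAt.congr_fderiv ?_
    ext v
    exact congrArg (fun D : E →L[ℝ] F ↦ D (mfderiv 𝓘(ℝ, E) I χ.symm y v)) (hf' (χ.symm y))
  have hconst {y : E} (hy : y ∈ Metric.ball (χ x) ε) : f (χ.symm y) = f (χ.symm (χ x)) :=
    Metric.isOpen_ball.is_const_of_fderiv_eq_zero (Metric.isPreconnected_ball (x := χ x) (r := ε))
      (fun z hz ↦ (hderiv z hz).differentiableAt.differentiableWithinAt)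
      (fun z hz ↦ (hderiv z hz).fderiv) hy (Metric.mem_ball_self hε)
  filter_upwards [extChartAt_source_mem_nhds (I := I) x,
    (continuousAt_extChartAt (I := I) x).preimage_mem_nhds (Metric.ball_mem_nhds _ hε)]
    with z hz hz'
  rw [← χ.left_inv hz, hconst hz', extChartAt_to_inv]

lemma eqOn_Icc_of_isMIntegralCurveOn_Ioo [CompleteSpace E] [I.Boundaryless] [IsManifold I 1 M]
    [T2Space M] {V : (x : M) → TangentSpace I x} (hV : CMDiff 1 (T% V))
    (hcomplete : ∀ x, ∃ γ : ℝ → M, γ 0 = x ∧ IsMIntegralCurve γ V) {γ σ : ℝ → M} {a b : ℝ}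
    (hγ_cont : ContinuousOn γ (Icc a b)) (hγ : IsMIntegralCurveOn γ V (Ioo a b))
    (hσ : IsMIntegralCurve σ V) (h : γ a = σ a) : EqOn γ σ (Icc a b) := by
  intro t ht
  rcases ht.1.trans ht.2 |>.eq_or_lt with rfl | hab
  · rwa [le_antisymm ht.2 ht.1]
  obtain ⟨c, hc⟩ := exists_between hab
  obtain ⟨τ, hτ₀, hτ⟩ := hcomplete (γ c)
  have hτc : γ c = τ (c + -c) := by rw [add_neg_cancel, hτ₀]
  have hτ' := hτ.comp_add (-c)
  have hγτ : EqOn γ (τ ∘ (· + -c)) (Icc a b) :=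
    (isMIntegralCurveOn_Ioo_eqOn_of_contMDiff_boundaryless hc hV hγ (hτ'.isMIntegralCurveOn _)
      hτc).of_subset_closure hγ_cont hτ'.continuous.continuousOn Ioo_subset_Icc_self
      (closure_Ioo hab.ne).ge
  have hστ : τ ∘ (· + -c) = σ := isMIntegralCurve_Ioo_eq_of_contMDiff_boundaryless hV hτ' hσ
    ((hγτ (left_mem_Icc.2 hab.le)).symm.trans h)
  exact hστ ▸ hγτ ht

end Manifold

variable {E : Type*} [NormedAddCommGroup E] [NormedSpace ℝ E]
  {H : Type*} [TopologicalSpace H] {I : ModelWithCorners ℝ E H}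
  {G : Type*} [TopologicalSpace G] [ChartedSpace H G] [Group G]

section InvariantFields

lemma rightInvariant_zero : rightInvariant (0 : GroupLieAlgebra I G) = 0 := by
  ext g
  exact (mfderiv I I (fun x : G ↦ x * g) 1).map_zero

lemma rightInvariant_add (v w : GroupLieAlgebra I G) :
    rightInvariant (v + w) = rightInvariant (G := G) v + rightInvariant w := by
  ext g
  exact (mfderiv I I (fun x : G ↦ x * g) 1).map_add v w

lemma rightInvariant_smul (c : ℝ) (v : GroupLieAlgebra I G) :
    rightInvariant (c • v) = c • rightInvariant (G := G) v := by
  ext g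
  exact (mfderiv I I (fun x : G ↦ x * g) 1).map_smul c v

lemma rightInvariant_sum {ι : Type*} (s : Finset ι) (v : ι → GroupLieAlgebra I G) :
    rightInvariant (∑ i ∈ s, v i) = ∑ i ∈ s, rightInvariant (G := G) (v i) := by
  ext g
  rw [Finset.sum_apply]
  exact map_sum (mfderiv I I (fun x : G ↦ x * g) 1) v s

lemma rightInvariant_one (v : GroupLieAlgebra I G) : rightInvariant v 1 = v := by
  have h : (fun x : G ↦ x * 1) = id := funext mul_one
  rw [rightInvariant, h, mfderiv_id]
  rfl

lemma mulInvariantVectorField_one (v : GroupLieAlgebra I G) :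
    mulInvariantVectorField v (1 : G) = v := by
  have h : (fun x : G ↦ 1 * x) = id := funext one_mul
  rw [mulInvariantVectorField, h, mfderiv_id]
  rfl

variable [LieGroup I ∞ G]

lemma mdifferentiableAt_mul_left (g h : G) : MDifferentiableAt I I (fun x ↦ g * x) h :=
  (contMDiff_mul_left (n := ∞)).mdifferentiableAt (by simp)

lemma mdifferentiableAt_mul_right (g h : G) : MDifferentiableAt I I (fun x ↦ x * g) h :=
  (contMDiff_mul_right (n := ∞)).mdifferentiableAt (by simp)

lemma mdifferentiableAt_inv (g : G) : MDifferentiableAt I I (fun x : G ↦ x⁻¹) g :=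
  (contMDiff_inv I ∞).mdifferentiableAt (by simp)

lemma mfderiv_mul_right_rightInvariant (h : G) (v : GroupLieAlgebra I G) (g : G) :
    mfderiv I I (fun x ↦ x * h) g (rightInvariant v g) = rightInvariant v (g * h) := by
  have hcomp : (fun x : G ↦ x * (g * h)) = (fun x ↦ x * h) ∘ (fun x ↦ x * g) := by
    ext x
    simp only [Function.comp_apply, mul_assoc]
  rw [rightInvariant, rightInvariant, hcomp]
  exact (mfderiv_comp_apply_of_eq (I' := I) _ (mdifferentiableAt_mul_right h g)
    (mdifferentiableAt_mul_right g 1) (one_mul g) v).symm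

lemma mfderiv_mul_left_mulInvariantVectorField (g : G) (v : GroupLieAlgebra I G) (h : G) :
    mfderiv I I (fun x ↦ g * x) h (mulInvariantVectorField v h) =
      mulInvariantVectorField v (g * h) := by
  have hcomp : (fun x : G ↦ g * h * x) = (fun x ↦ g * x) ∘ (fun x ↦ h * x) := by
    ext x
    simp only [Function.comp_apply, mul_assoc]
  rw [mulInvariantVectorField, mulInvariantVectorField, hcomp]
  exact (mfderiv_comp_apply_of_eq (I' := I) _ (mdifferentiableAt_mul_left g h)
    (mdifferentiableAt_mul_left h 1) (mul_one h) v).symm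

lemma mfderiv_mul_left_rightInvariant (g : G) (v : GroupLieAlgebra I G) (h : G) :
    mfderiv I I (fun x ↦ g * x) h (rightInvariant v h) =
      rightInvariant (mfderiv I I (fun x : G ↦ g * x * g⁻¹) 1 v : E) (g * h) := by
  have hcomp : (fun x : G ↦ g * x) ∘ (fun x ↦ x * h) =
      (fun x ↦ x * (g * h)) ∘ fun x ↦ g * x * g⁻¹ := by
    ext x
    simp [mul_assoc]
  have h₁ := mfderiv_comp_apply_of_eq (I' := I) (x := (1 : G)) (f := fun x ↦ x * h)
    (mdifferentiableAt_mul_left g h) (mdifferentiableAt_mul_right h 1) (one_mul h) v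
  have h₂ := mfderiv_comp_apply_of_eq (x := (1 : G)) (y := 1) (f := fun x : G ↦ g * x * g⁻¹)
    (mdifferentiableAt_mul_right (g * h) 1)
    ((mdifferentiableAt_mul_right g⁻¹ (g * 1)).comp 1 (mdifferentiableAt_mul_left g 1))
    (by simp) v
  rw [hcomp] at h₁
  exact h₁.symm.trans h₂

end InvariantFields

section ProductRule

variable [LieGroup I ∞ G] {E' : Type*} [NormedAddCommGroup E'] [NormedSpace ℝ E']
  {H' : Type*} [TopologicalSpace H'] {J : ModelWithCorners ℝ E' H'}
  {M : Type*} [TopologicalSpace M] [ChartedSpace H' M]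

lemma mfderiv_mul_apply {g h : G} (v : TangentSpace I g) (w : TangentSpace I h) :
    mfderiv (I.prod I) I (fun p : G × G ↦ p.1 * p.2) (g, h) ((v, w) : E × E) =
      mfderiv I I (fun x ↦ x * h) g v + mfderiv I I (fun x ↦ g * x) h w :=
  mfderiv_prod_eq_add_apply (v := ((v, w) : E × E))
    ((contMDiff_mul I ∞).mdifferentiableAt (by simp))

lemma hasMFDerivAt_mul {a b : M → G} {x : M} {a' : TangentSpace J x →L[ℝ] TangentSpace I (a x)}
    {b' : TangentSpace J x →L[ℝ] TangentSpace I (b x)} (ha : HasMFDerivAt J I a x a')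
    (hb : HasMFDerivAt J I b x b') :
    HasMFDerivAt J I (fun y ↦ a y * b y) x
      ((mfderiv I I (fun y ↦ y * b x) (a x)).comp a' +
        (mfderiv I I (fun y ↦ a x * y) (b x)).comp b' : E' →L[ℝ] E) := by
  have hmul : MDifferentiableAt (I.prod I) I (fun p : G × G ↦ p.1 * p.2) (a x, b x) :=
    (contMDiff_mul I ∞).mdifferentiableAt (by simp)
  refine (hmul.hasMFDerivAt.comp x (ha.prodMk hb)).congr_mfderiv ?_
  ext v
  exact mfderiv_mul_apply (a' v) (b' v)

lemma hasMFDerivAt_mul_curve {a b : ℝ → G} {t : ℝ} {v : TangentSpace I (a t)}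
    {w : TangentSpace I (b t)}
    (ha : HasMFDerivAt 𝓘(ℝ, ℝ) I a t ((1 : ℝ →L[ℝ] ℝ).smulRight v))
    (hb : HasMFDerivAt 𝓘(ℝ, ℝ) I b t ((1 : ℝ →L[ℝ] ℝ).smulRight w)) :
    HasMFDerivAt 𝓘(ℝ, ℝ) I (fun s ↦ a s * b s) t ((1 : ℝ →L[ℝ] ℝ).smulRight
      (mfderiv I I (fun x ↦ x * b t) (a t) v + mfderiv I I (fun x ↦ a t * x) (b t) w)) := by
  refine (hasMFDerivAt_mul ha hb).congr_mfderiv ?_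
  ext
  change mfderiv I I (fun x ↦ x * b t) (a t) ((1 : ℝ) • v) +
    mfderiv I I (fun x ↦ a t * x) (b t) ((1 : ℝ) • w) = (1 : ℝ) • (_ + _)
  rw [one_smul, one_smul, one_smul]

lemma contMDiff_tangent_mul {A B : M → TangentBundle I G} (hA : ContMDiff J I.tangent ∞ A)
    (hB : ContMDiff J I.tangent ∞ B) :
    ContMDiff J I.tangent ∞ (fun y ↦ (⟨(A y).1 * (B y).1,
      mfderiv I I (fun x ↦ x * (B y).1) (A y).1 (A y).2 +
        mfderiv I I (fun x ↦ (A y).1 * x) (B y).1 (B y).2⟩ : TangentBundle I G)) := by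
  have hpair : ContMDiff (I.tangent.prod I.tangent) (I.prod I).tangent ∞
    (equivTangentBundleProd I G I G).symm := contMDiff_equivTangentBundleProd_symm
  have hmul : ContMDiff (I.prod I).tangent I.tangent ∞
      (tangentMap (I.prod I) I (fun p : G × G ↦ p.1 * p.2)) :=
    (contMDiff_mul I ∞).contMDiff_tangentMap (by simp)
  refine ((hmul.comp hpair).comp (hA.prodMk hB)).congr fun y ↦ ?_
  exact congrArg (fun v ↦ (⟨(A y).1 * (B y).1, v⟩ : TangentBundle I G))
    (mfderiv_mul_apply (A y).2 (B y).2).symm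

lemma contMDiff_rightInvariant (v : GroupLieAlgebra I G) :
    CMDiff ∞ (T% (rightInvariant (G := G) v)) := by
  refine (contMDiff_tangent_mul (A := fun _ : G ↦ ⟨1, v⟩) (B := fun g ↦ ⟨g, 0⟩)
    contMDiff_const (contMDiff_zeroSection ℝ _)).congr fun g ↦ ?_
  refine TotalSpace.ext (one_mul g).symm (heq_of_eq ?_)
  let D : E →L[ℝ] E := mfderiv I I (fun x : G ↦ 1 * x) g
  let r : E := rightInvariant v g
  change r = r + D 0
  rw [map_zero, add_zero]

lemma contMDiff_mulInvariantVectorField_infty (v : GroupLieAlgebra I G) :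
    CMDiff ∞ (T% (mulInvariantVectorField (G := G) v)) := by
  refine (contMDiff_tangent_mul (A := fun g ↦ ⟨g, 0⟩) (B := fun _ : G ↦ ⟨1, v⟩)
    (contMDiff_zeroSection ℝ _) contMDiff_const).congr fun g ↦ ?_
  refine TotalSpace.ext (mul_one g).symm (heq_of_eq ?_)
  let D : E →L[ℝ] E := mfderiv I I (fun x : G ↦ x * 1) g
  let l : E := mulInvariantVectorField v g
  change l = D 0 + l
  rw [map_zero, zero_add]

end ProductRule

section Bracket

variable [LieGroup I ∞ G]

/-- Right translation `x ↦ x * g` as a diffeomorphism. -/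
def rightTranslation (g : G) : Diffeomorph I I G G ∞ where
  toEquiv := Equiv.mulRight g
  contMDiff_toFun := contMDiff_mul_right
  contMDiff_invFun := contMDiff_mul_right

/-- Left translation `x ↦ g * x` as a diffeomorphism. -/
def leftTranslation (g : G) : Diffeomorph I I G G ∞ where
  toEquiv := Equiv.mulLeft g
  contMDiff_toFun := contMDiff_mul_left
  contMDiff_invFun := contMDiff_mul_left

/-- Inversion `x ↦ x⁻¹` as a diffeomorphism. -/
def inversion : Diffeomorph I I G G ∞ where
  toEquiv := Equiv.inv G
  contMDiff_toFun := contMDiff_inv I ∞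
  contMDiff_invFun := contMDiff_inv I ∞

lemma mfderiv_mul_left_injective (g h : G) :
    Function.Injective (mfderiv I I (fun x ↦ g * x) h) :=
  ((leftTranslation (I := I) g).mfderivToContinuousLinearEquiv (by simp) h).injective

lemma mfderiv_inv_injective (g : G) : Function.Injective (mfderiv I I (fun x : G ↦ x⁻¹) g) :=
  ((inversion (I := I) (G := G)).mfderivToContinuousLinearEquiv (by simp) g).injective

lemma mfderiv_mul_left_mfderiv_inv (g : G) (v : TangentSpace I g) :
    mfderiv I I (fun x ↦ g * x) g⁻¹ (mfderiv I I (fun x : G ↦ x⁻¹) g v) =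
      (-mfderiv I I (fun x ↦ x * g⁻¹) g v : E) := by
  have hprod := hasMFDerivAt_mul (hasMFDerivAt_id (I := I) g)
    (mdifferentiableAt_inv g).hasMFDerivAt
  have hconst : (fun x : G ↦ id x * x⁻¹) = fun _ ↦ 1 := funext mul_inv_cancel
  rw [hconst] at hprod
  have h := congrArg (fun D : E →L[ℝ] E ↦ D v)
    (hasMFDerivAt_unique hprod (hasMFDerivAt_const _ _))
  exact eq_neg_of_add_eq_zero_right h

lemma mfderiv_inv_rightInvariant (v : GroupLieAlgebra I G) (g : G) :
    mfderiv I I (fun x : G ↦ x⁻¹) g (rightInvariant v g) = mulInvariantVectorField (-v) g⁻¹ := by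
  have hR : (rightInvariant v (g * g⁻¹) : E) = v := by rw [mul_inv_cancel, rightInvariant_one]
  have hL : (mulInvariantVectorField (-v) (g * g⁻¹) : E) = -v := by
    rw [mul_inv_cancel, mulInvariantVectorField_one]
  apply mfderiv_mul_left_injective g g⁻¹
  rw [mfderiv_mul_left_mfderiv_inv, mfderiv_mul_right_rightInvariant,
    mfderiv_mul_left_mulInvariantVectorField]
  exact (congrArg Neg.neg hR).trans hL.symm

lemma mfderiv_inv_mulInvariantVectorField (v : GroupLieAlgebra I G) (g : G) :
    mfderiv I I (fun x : G ↦ x⁻¹) g (mulInvariantVectorField v g) = rightInvariant (-v) g⁻¹ := by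
  have hinv := mfderiv_comp_apply (I' := I) g (mdifferentiableAt_inv g⁻¹) (mdifferentiableAt_inv g)
    (mulInvariantVectorField v g)
  have hid : (fun x : G ↦ x⁻¹) ∘ (fun x ↦ x⁻¹) = id := funext inv_inv
  have hL : (mulInvariantVectorField v g⁻¹⁻¹ : E) = mulInvariantVectorField v g := by rw [inv_inv]
  rw [hid, mfderiv_id] at hinv
  apply mfderiv_inv_injective g⁻¹
  rw [mfderiv_inv_rightInvariant, neg_neg]
  exact hinv.symm.trans hL.symm

lemma inversionField_rightInvariant (v : GroupLieAlgebra I G) :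
    inversionField (rightInvariant v) = mulInvariantVectorField (G := G) (-v) := by
  ext g
  have hL : (mulInvariantVectorField (-v) g⁻¹⁻¹ : E) = mulInvariantVectorField (-v) g := by
    rw [inv_inv]
  exact (mfderiv_inv_rightInvariant v g⁻¹).trans hL

lemma mlieBracket_rightInvariant [CompleteSpace E] (v w : GroupLieAlgebra I G) :
    mlieBracket I (rightInvariant v) (rightInvariant w) = rightInvariant (G := G) (-⁅v, w⁆) := by
  ext g
  apply mfderiv_inv_injective g
  have h := mfderiv_mlieBracket_of_related (inversion (I := I) (G := G))
    (mfderiv_inv_rightInvariant v) (mfderiv_inv_rightInvariant w)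
    (mdifferentiable_mulInvariantVectorField _) (mdifferentiable_mulInvariantVectorField _) g
  rw [← mulInvariantVector_mlieBracket, ← GroupLieAlgebra.bracket_def, neg_lie, lie_neg,
    neg_neg] at h
  rw [mfderiv_inv_rightInvariant, neg_neg]
  exact h

end Bracket

section Exponential

variable [LieGroup I ∞ G] [I.Boundaryless] [T2Space G]

lemma isMIntegralCurve_rightInvariant_unique {v : GroupLieAlgebra I G} {γ γ' : ℝ → G} {t : ℝ}
    (hγ : IsMIntegralCurve γ (rightInvariant v)) (hγ' : IsMIntegralCurve γ' (rightInvariant v))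
    (h : γ t = γ' t) : γ = γ' :=
  isMIntegralCurve_Ioo_eq_of_contMDiff_boundaryless
    ((contMDiff_rightInvariant v).of_le (by simp)) hγ hγ' h

lemma lieExp_smul_eq {v : GroupLieAlgebra I G} {γ : ℝ → G} (hγ₀ : γ 0 = 1)
    (hγ : IsMIntegralCurve γ (rightInvariant v)) (t : ℝ) : lieExp (t • v) = γ t := by
  have hγt : IsMIntegralCurve (fun s ↦ γ (s * t)) (rightInvariant (t • v)) := by
    rw [rightInvariant_smul]
    exact hγ.comp_mul t
  have hγt₀ : γ (0 * t) = 1 := by rw [zero_mul, hγ₀]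
  obtain ⟨hε₀, hε⟩ := Classical.epsilon_spec (p := fun γ : ℝ → G ↦ γ 0 = 1 ∧
    IsMIntegralCurve γ (rightInvariant (t • v))) ⟨_, hγt₀, hγt⟩
  have h := isMIntegralCurve_rightInvariant_unique hε hγt (hε₀.trans hγt₀.symm)
  exact (congrFun h 1).trans (congrArg γ (one_mul t))

variable [CompleteSpace E]

lemma exists_isMIntegralCurve_rightInvariant (v : GroupLieAlgebra I G) :
    ∃ γ : ℝ → G, γ 0 = 1 ∧ IsMIntegralCurve γ (rightInvariant v) := by
  have hv : CMDiff 1 (T% (rightInvariant (G := G) v)) :=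
    (contMDiff_rightInvariant v).of_le (by simp)
  obtain ⟨γ, hγ₀, hγ⟩ := exists_isMIntegralCurveAt_of_contMDiffAt_boundaryless 0
    (hv.contMDiffAt (x := 1))
  obtain ⟨ε, hε, hγ⟩ := isMIntegralCurveAt_iff'.1 hγ
  rw [Real.ball_zero_eq_Ioo] at hγ
  -- Right translates of the local curve through `1` have the same lifetime at every base point.
  refine exists_isMIntegralCurve_of_isMIntegralCurveOn hv hε (fun g ↦ ?_) 1
  refine ⟨fun t ↦ γ t * g, by simp [hγ₀], fun t ht ↦ ?_⟩
  have h := hasMFDerivAt_comp_curve (mdifferentiableAt_mul_right g (γ t))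
    ((hγ t ht).hasMFDerivAt (isOpen_Ioo.mem_nhds ht))
  rw [mfderiv_mul_right_rightInvariant] at h
  exact h.hasMFDerivWithinAt

lemma isMIntegralCurve_lieExp (v : GroupLieAlgebra I G) :
    IsMIntegralCurve (fun t : ℝ ↦ (lieExp (t • v) : G)) (rightInvariant v) := by
  obtain ⟨γ, hγ₀, hγ⟩ := exists_isMIntegralCurve_rightInvariant (G := G) v
  simpa only [lieExp_smul_eq hγ₀ hγ] using hγ

lemma lieExp_zero : lieExp (0 : GroupLieAlgebra I G) = 1 := by
  obtain ⟨γ, hγ₀, hγ⟩ := exists_isMIntegralCurve_rightInvariant (0 : GroupLieAlgebra I G)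
  rw [← smul_zero (0 : ℝ), lieExp_smul_eq hγ₀ hγ 0, hγ₀]

lemma lieExp_add_smul (v : GroupLieAlgebra I G) (s t : ℝ) :
    (lieExp ((s + t) • v) : G) = lieExp (s • v) * lieExp (t • v) := by
  have hshift := (isMIntegralCurve_lieExp (G := G) v).comp_add t
  have hmul : IsMIntegralCurve (fun r : ℝ ↦ (lieExp (r • v) : G) * lieExp (t • v))
      (rightInvariant v) := fun r ↦ by
    have h := hasMFDerivAt_comp_curve (mdifferentiableAt_mul_right (lieExp (t • v)) _)
      (isMIntegralCurve_lieExp v r)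
    rwa [mfderiv_mul_right_rightInvariant] at h
  have h₀ : (lieExp ((0 + t) • v) : G) = lieExp ((0 : ℝ) • v) * lieExp (t • v) := by
    rw [zero_add, zero_smul, lieExp_zero, one_mul]
  exact congrFun (isMIntegralCurve_rightInvariant_unique hshift hmul h₀) s

lemma rightInvariant_lieExp (v : GroupLieAlgebra I G) (t : ℝ) :
    rightInvariant v (lieExp (t • v) : G) = mulInvariantVectorField v (lieExp (t • v)) := by
  have hshift := (isMIntegralCurve_lieExp (G := G) v).comp_add t 0
  have hmul := hasMFDerivAt_comp_curve (mdifferentiableAt_mul_left (lieExp (t • v) : G) _)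
    (isMIntegralCurve_lieExp v 0)
  have hcomm : (fun s : ℝ ↦ (lieExp (s • v) : G)) ∘ (· + t) =
      fun s ↦ lieExp (t • v) * lieExp (s • v) := by
    ext s
    rw [Function.comp_apply, add_comm, lieExp_add_smul]
  rw [hcomm] at hshift
  have h : (rightInvariant v (lieExp (t • v) * lieExp ((0 : ℝ) • v)) : E) =
      mfderiv I I (fun x ↦ lieExp (t • v) * x) (lieExp ((0 : ℝ) • v))
        (rightInvariant v (lieExp ((0 : ℝ) • v))) := velocity_unique hshift hmul
  rw [zero_smul, lieExp_zero, rightInvariant_one, mul_one] at h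
  exact h

lemma isMIntegralCurve_lieExp_mul_mul (A B : GroupLieAlgebra I G) (g : G) :
    IsMIntegralCurve (fun t : ℝ ↦ lieExp (t • A) * g * lieExp (t • B))
      (rightInvariant A + mulInvariantVectorField B) := fun t ↦ by
  have hA := hasMFDerivAt_comp_curve (mdifferentiableAt_mul_right g _)
    (isMIntegralCurve_lieExp (G := G) A t)
  rw [mfderiv_mul_right_rightInvariant] at hA
  have hB := isMIntegralCurve_lieExp (G := G) B t
  simp only [rightInvariant_lieExp] at hB
  have h := hasMFDerivAt_mul_curve hA hB
  rwa [mfderiv_mul_right_rightInvariant, mfderiv_mul_left_mulInvariantVectorField] at h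

end Exponential

section Commutation

variable [LieGroup I ∞ G]

lemma mdifferentiable_rightInvariant (v : GroupLieAlgebra I G) :
    MDiff (T% (rightInvariant (G := G) v)) :=
  (contMDiff_rightInvariant v).mdifferentiable (by simp)

variable [CompleteSpace E]

lemma mlieBracket_mulInvariantVectorField_rightInvariant_symm (v w : GroupLieAlgebra I G) :
    mlieBracket I (mulInvariantVectorField v) (rightInvariant w) (1 : G) =
      mlieBracket I (mulInvariantVectorField w) (rightInvariant v) (1 : G) := by
  have hneg (u : GroupLieAlgebra I G) : mfderiv I I (fun x : G ↦ x⁻¹) 1 u = (-u : E) := by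
    have h : (mfderiv I I (fun x : G ↦ x⁻¹) 1 (rightInvariant u 1) : E) =
      mulInvariantVectorField (-u) (1 : G)⁻¹ := mfderiv_inv_rightInvariant u 1
    rwa [rightInvariant_one, inv_one, mulInvariantVectorField_one] at h
  have h : (mfderiv I I (fun x : G ↦ x⁻¹) 1
        (mlieBracket I (mulInvariantVectorField v) (rightInvariant w) 1) : E) =
      mlieBracket I (rightInvariant (-v)) (mulInvariantVectorField (-w)) (1 : G)⁻¹ :=
    mfderiv_mlieBracket_of_related inversion
      (mfderiv_inv_mulInvariantVectorField v) (mfderiv_inv_rightInvariant w)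
      (mdifferentiable_rightInvariant _) (mdifferentiable_mulInvariantVectorField _) 1
  rw [hneg, inv_one, mlieBracket_swap_apply (V := rightInvariant (-v)), ← neg_one_smul ℝ v,
    ← neg_one_smul ℝ w, rightInvariant_smul, mulInvariantVectorField_smul,
    mlieBracket_const_smul_left (mdifferentiable_mulInvariantVectorField w 1),
    mlieBracket_const_smul_right (mdifferentiable_rightInvariant v 1), smul_smul] at h
  simpa using h

variable [I.Boundaryless] [T2Space G]

lemma mlieBracket_mulInvariantVectorField_rightInvariant_self (v : GroupLieAlgebra I G) :
    mlieBracket I (mulInvariantVectorField v) (rightInvariant v) (1 : G) = 0 := by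
  let W : (g : G) → TangentSpace I g := rightInvariant v - mulInvariantVectorField v
  have hW : MDiff (T% W) :=
    fun g ↦ mdifferentiableAt_sub_section (mdifferentiable_rightInvariant v g)
      (mdifferentiable_mulInvariantVectorField v g)
  have hexp := isMIntegralCurve_lieExp (G := G) v 0
  rw [rightInvariant_lieExp] at hexp
  have h := mlieBracket_eq_zero_of_eventually_zero_along_curve hexp (hW _)
    (Eventually.of_forall fun s ↦ sub_eq_zero.2 (rightInvariant_lieExp v s))
  rw [zero_smul, lieExp_zero] at h
  rw [← sub_add_cancel (rightInvariant v) (mulInvariantVectorField v),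
    mlieBracket_add_right (hW 1) (mdifferentiable_mulInvariantVectorField v 1), h,
    mlieBracket_self, Pi.zero_apply, add_zero]

lemma mlieBracket_mulInvariantVectorField_rightInvariant_swap (v w : GroupLieAlgebra I G) :
    mlieBracket I (mulInvariantVectorField v) (rightInvariant w) (1 : G) =
      -mlieBracket I (mulInvariantVectorField w) (rightInvariant v) (1 : G) := by
  have hL (u : GroupLieAlgebra I G) := mdifferentiable_mulInvariantVectorField (G := G) u 1
  have hR (u : GroupLieAlgebra I G) := mdifferentiable_rightInvariant (G := G) u 1
  have h := mlieBracket_mulInvariantVectorField_rightInvariant_self (G := G) (v + w)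
  rw [rightInvariant_add, mulInvariantVectorField_add, mlieBracket_add_left (hL v) (hL w),
    mlieBracket_add_right (hR v) (hR w), mlieBracket_add_right (hR v) (hR w),
    mlieBracket_mulInvariantVectorField_rightInvariant_self,
    mlieBracket_mulInvariantVectorField_rightInvariant_self, zero_add, add_zero] at h
  exact eq_neg_of_add_eq_zero_left h

lemma mlieBracket_mulInvariantVectorField_rightInvariant (v w : GroupLieAlgebra I G) :
    mlieBracket I (mulInvariantVectorField v) (rightInvariant w) =
      (0 : (g : G) → TangentSpace I g) := by
  have h₁ (w : GroupLieAlgebra I G) :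
      mlieBracket I (mulInvariantVectorField v) (rightInvariant w) (1 : G) = 0 := by
    have h := mlieBracket_mulInvariantVectorField_rightInvariant_swap (G := G) v w
    rw [mlieBracket_mulInvariantVectorField_rightInvariant_symm w] at h
    have : IsAddTorsionFree E := .of_isTorsionFree ℝ E
    exact self_eq_neg (G := E).1 h
  ext g
  apply mfderiv_mul_left_injective g⁻¹ g
  have h := mfderiv_mlieBracket_of_related (leftTranslation (I := I) g⁻¹)
    (mfderiv_mul_left_mulInvariantVectorField g⁻¹ v) (mfderiv_mul_left_rightInvariant g⁻¹ w)
    (mdifferentiable_mulInvariantVectorField v) (mdifferentiable_rightInvariant _) g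
  have hg : (mlieBracket I (mulInvariantVectorField v)
      (rightInvariant (mfderiv I I (fun x : G ↦ g⁻¹ * x * g⁻¹⁻¹) 1 w : E)) (g⁻¹ * g) : E) = 0 := by
    rw [inv_mul_cancel]
    exact h₁ _
  exact (h.trans hg).trans (map_zero _).symm

end Commutation

section LeftTrivialization

lemma mulInvariantVectorField_eq_sum_coord {ι : Type*} [Fintype ι]
    (b : Module.Basis ι ℝ (GroupLieAlgebra I G)) (v : GroupLieAlgebra I G) (g : G) :
    mulInvariantVectorField v g = ∑ i, b.coord i v • mulInvariantVectorField (b i) g := by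
  let D : GroupLieAlgebra I G →L[ℝ] E := mfderiv I I (fun x : G ↦ g * x) 1
  have h : D v = ∑ i, b.coord i v • D (b i) := by
    conv_lhs => rw [← b.sum_repr v, map_sum]
    simp only [map_smul, Module.Basis.coord_apply]
  exact h

variable [LieGroup I ∞ G] {V : (g : G) → TangentSpace I g}

lemma rightInvariant_surjective (g : G) :
    Function.Surjective fun v : GroupLieAlgebra I G ↦ rightInvariant v g := fun v ↦
  ((rightTranslation (I := I) g).mfderivToContinuousLinearEquiv (by simp) 1).surjective (v : E)

/-- The vector field `V` in the trivialization of the tangent bundle by left translations: its value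
at `g` is `V g` moved to the identity. -/
noncomputable def leftCoeff (V : (g : G) → TangentSpace I g) (g : G) : GroupLieAlgebra I G :=
  (mfderiv I I (fun x ↦ g⁻¹ * x) g (V g) : E)

lemma mulInvariantVectorField_leftCoeff (V : (g : G) → TangentSpace I g) (g : G) :
    mulInvariantVectorField (leftCoeff V g) g = V g := by
  have h := mfderiv_comp_apply_of_eq (I' := I) (x := g) (y := (1 : G))
    (f := fun x : G ↦ g⁻¹ * x) (g := fun x : G ↦ g * x)
    (mdifferentiableAt_mul_left g 1) (mdifferentiableAt_mul_left g⁻¹ g) (inv_mul_cancel g) (V g)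
  have hid : (fun x : G ↦ g * x) ∘ (fun x ↦ g⁻¹ * x) = id := funext (mul_inv_cancel_left g)
  rw [hid, mfderiv_id] at h
  exact h.symm

lemma leftCoeff_one (V : (g : G) → TangentSpace I g) : leftCoeff V 1 = V 1 := by
  rw [← mulInvariantVectorField_one (leftCoeff V 1), mulInvariantVectorField_leftCoeff]

lemma trivializationAt_one_apply (v : GroupLieAlgebra I G) :
    (trivializationAt E (TangentSpace I) (1 : G) ⟨1, v⟩).2 = v := by
  rw [TangentBundle.trivializationAt_apply]
  exact congrArg (fun D : E →L[ℝ] E ↦ D v)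
    (fderivWithin_extChartAt_comp_extChartAt_symm_range (I := I) (x := (1 : G)))

lemma contMDiff_leftCoeff (hV : CMDiff ∞ (T% V)) :
    ContMDiff (M' := E) I 𝓘(ℝ, E) ∞ (leftCoeff V) := by
  have hmul := contMDiff_tangent_mul (I := I) (A := fun g : G ↦ ⟨g⁻¹, 0⟩) (B := fun g ↦ ⟨g, V g⟩)
    ((contMDiff_zeroSection ℝ (TangentSpace I)).comp (contMDiff_inv I ∞)) hV
  have hone : ContMDiff I I.tangent ∞
      (fun g : G ↦ (⟨1, leftCoeff V g⟩ : TangentBundle I G)) := by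
    refine hmul.congr fun g ↦ TotalSpace.ext (inv_mul_cancel g).symm (heq_of_eq ?_)
    let D : E →L[ℝ] E := mfderiv I I (fun x ↦ x * g) g⁻¹
    let u : E := leftCoeff V g
    change u = D 0 + u
    rw [map_zero, zero_add]
  exact fun g ↦ (contMDiffAt_totalSpace.1 (hone g)).2.congr_of_eventuallyEq
    (Eventually.of_forall fun x ↦ (trivializationAt_one_apply (leftCoeff V x)).symm)

variable [I.Boundaryless] [T2Space G] [FiniteDimensional ℝ E]

lemma mlieBracket_rightInvariant_eq_leftCoeff (w : GroupLieAlgebra I G) (hV : CMDiff ∞ (T% V))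
    (g : G) : mlieBracket I (rightInvariant w) V g =
      mulInvariantVectorField (mvfderiv (F := E) I (leftCoeff V) g (rightInvariant w g)) g := by
  have : CompleteSpace E := FiniteDimensional.complete ℝ E
  have : Module.Finite ℝ (GroupLieAlgebra I G) := inferInstanceAs (Module.Finite ℝ E)
  let b := Module.finBasis ℝ (GroupLieAlgebra I G)
  let coeff (i) (x : G) : ℝ := b.coord i (leftCoeff V x)
  let coordL (i) : E →L[ℝ] ℝ := LinearMap.toContinuousLinearMap (b.coord i)
  let u : GroupLieAlgebra I G := mvfderiv (F := E) I (leftCoeff V) g (rightInvariant w g)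
  have hV' : MDifferentiableAt (M' := E) I 𝓘(ℝ, E) (leftCoeff V) g :=
    (contMDiff_leftCoeff hV).mdifferentiable (by simp) g
  have hcoeff (i) : MDiffAt (coeff i) g := (coordL i).mdifferentiableAt.comp g hV'
  have hderiv (i) : mvfderiv I (coeff i) g (rightInvariant w g) = b.coord i u :=
    mvfderiv_clm_comp_apply (coordL i) hV' _
  have hsum : V = ∑ i, coeff i • mulInvariantVectorField (b i) := by
    ext x
    rw [← mulInvariantVectorField_leftCoeff V x, mulInvariantVectorField_eq_sum_coord b,
      Finset.sum_apply]
    rfl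
  change _ = mulInvariantVectorField u g
  rw [mulInvariantVectorField_eq_sum_coord b]
  conv_lhs => rw [hsum]
  rw [mlieBracket_sum_smul_right _ (fun i _ ↦ hcoeff i)
    (fun i _ ↦ mdifferentiable_mulInvariantVectorField (b i) g)]
  refine Finset.sum_congr rfl fun i _ ↦ ?_
  rw [hderiv, mlieBracket_swap_apply, mlieBracket_mulInvariantVectorField_rightInvariant,
    Pi.zero_apply, neg_zero, smul_zero, add_zero]

lemma eq_mulInvariantVectorField_of_commute [ConnectedSpace G] (hV : CMDiff ∞ (T% V))
    (hcomm : ∀ w : GroupLieAlgebra I G, mlieBracket I (rightInvariant w) V = 0) :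
    V = mulInvariantVectorField (V 1) := by
  have hderiv (g : G) : mvfderiv (F := E) I (leftCoeff V) g = 0 := by
    ext v
    obtain ⟨w, rfl⟩ := rightInvariant_surjective g v
    have h := (mlieBracket_rightInvariant_eq_leftCoeff w hV g).symm.trans (congrFun (hcomm w) g)
    exact mfderiv_mul_left_injective g 1 (h.trans (map_zero _).symm)
  have hconst (g : G) : leftCoeff V g = V 1 := by
    rw [← leftCoeff_one V]
    exact (isLocallyConstant_of_mvfderiv_eq_zero ((contMDiff_leftCoeff hV).mdifferentiable
      (by simp)) hderiv).apply_eq_of_preconnectedSpace g 1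
  ext g
  rw [← mulInvariantVectorField_leftCoeff V g, hconst]

end LeftTrivialization

section Solutions

variable {m : ℕ} {V : (g : G) → TangentSpace I g} {Y : Fin m → GroupLieAlgebra I G}
  {u : ℝ → Fin m → ℝ} {c : Fin m → ℝ} {γ : ℝ → G} {J : Set ℝ}

lemma isSolutionOn_of_isMIntegralCurve
    (hγ : IsMIntegralCurve γ (V + ∑ j, c j • rightInvariant (Y j))) (hu : ∀ t ∈ J, u t = c) :
    IsSolutionOn V Y u (γ 0) γ J where
  initial := rfl
  continuousOn := hγ.continuous.continuousOn
  equation t ht _ := by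
    rw [hu t ht]
    simpa only [Pi.add_apply, Finset.sum_apply, Pi.smul_apply] using (hγ t).hasMFDerivWithinAt

lemma IsSolutionOn.isMIntegralCurveOn {g₀ : G} (hγ : IsSolutionOn V Y u g₀ γ J) {U : Set ℝ}
    (hU : IsOpen U) (hUJ : U ⊆ J) (hu : ∀ t ∈ U, u t = c) :
    IsMIntegralCurveOn γ (V + ∑ j, c j • rightInvariant (Y j)) U := fun t ht ↦ by
  have hU_nhds := hU.mem_nhds ht
  have huc : ∀ᶠ s in 𝓝[J] t, u s = u t := by
    filter_upwards [nhdsWithin_le_nhds hU_nhds] with s hs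
    rw [hu s hs, hu t ht]
  have h := (hγ.equation t (hUJ ht) huc).mono hUJ
  rw [hu t ht] at h
  simpa only [Pi.add_apply, Finset.sum_apply, Pi.smul_apply] using h

lemma rightInvariant_add_mulInvariantVectorField_add_sum {ι : Type*} [Fintype ι]
    (A B : GroupLieAlgebra I G) (c : ι → ℝ) (Y : ι → GroupLieAlgebra I G) :
    rightInvariant A + mulInvariantVectorField B + ∑ j, c j • rightInvariant (Y j) =
      rightInvariant (A + ∑ j, c j • Y j) + mulInvariantVectorField (G := G) B := by
  rw [rightInvariant_add, rightInvariant_sum, add_right_comm]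
  simp only [rightInvariant_smul]

variable [LieGroup I ∞ G]

lemma contMDiff_rightInvariant_add_mulInvariantVectorField (A B : GroupLieAlgebra I G) :
    CMDiff ∞ (T% (rightInvariant A + mulInvariantVectorField B : (g : G) → TangentSpace I g)) :=
  (contMDiff_rightInvariant A).add_section (contMDiff_mulInvariantVectorField_infty B)

variable [I.Boundaryless] [T2Space G] [CompleteSpace E] {A B : GroupLieAlgebra I G}

lemma eq_lieExp_mul_mul_of_isMIntegralCurve
    (hγ : IsMIntegralCurve γ (rightInvariant A + mulInvariantVectorField B)) (t : ℝ) :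
    γ t = lieExp (t • A) * γ 0 * lieExp (t • B) := by
  have h₀ : γ 0 = lieExp ((0 : ℝ) • A) * γ 0 * lieExp ((0 : ℝ) • B) := by
    simp only [zero_smul, lieExp_zero, one_mul, mul_one]
  exact congrFun (isMIntegralCurve_Ioo_eq_of_contMDiff_boundaryless
    ((contMDiff_rightInvariant_add_mulInvariantVectorField A B).of_le (by simp)) hγ
    (isMIntegralCurve_lieExp_mul_mul A B (γ 0)) h₀) t

lemma eqOn_lieExp_mul_mul_of_isMIntegralCurveOn_Ioo {T : ℝ} (hγ_cont : ContinuousOn γ (Icc 0 T))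
    (hγ : IsMIntegralCurveOn γ (rightInvariant A + mulInvariantVectorField B) (Ioo 0 T)) :
    EqOn γ (fun t ↦ lieExp (t • A) * γ 0 * lieExp (t • B)) (Icc 0 T) := by
  have h₀ (g : G) : lieExp ((0 : ℝ) • A) * g * lieExp ((0 : ℝ) • B) = g := by
    simp only [zero_smul, lieExp_zero, one_mul, mul_one]
  exact eqOn_Icc_of_isMIntegralCurveOn_Ioo
    ((contMDiff_rightInvariant_add_mulInvariantVectorField A B).of_le (by simp))
    (fun g ↦ ⟨_, h₀ g, isMIntegralCurve_lieExp_mul_mul A B g⟩) hγ_cont hγ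
    (isMIntegralCurve_lieExp_mul_mul A B (γ 0)) (h₀ (γ 0)).symm

lemma isSolutionOn_lieExp_mul_mul (hu : ∀ t ∈ J, u t = c) (g₀ : G) :
    IsSolutionOn (rightInvariant A + mulInvariantVectorField B) Y u g₀
      (fun t ↦ lieExp (t • (A + ∑ j, c j • Y j)) * g₀ * lieExp (t • B)) J := by
  have hcurve := isMIntegralCurve_lieExp_mul_mul (A + ∑ j, c j • Y j) B g₀
  rw [← rightInvariant_add_mulInvariantVectorField_add_sum] at hcurve
  simpa only [zero_smul, lieExp_zero, one_mul, mul_one] using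
    isSolutionOn_of_isMIntegralCurve hcurve hu

lemma IsSolutionOn.eqOn_lieExp_mul_mul {g₀ : G} {T : ℝ}
    (hγ : IsSolutionOn (rightInvariant A + mulInvariantVectorField B) Y u g₀ γ J)
    (hJ : Icc 0 T ⊆ J) (hu : ∀ t ∈ Icc 0 T, u t = c) :
    EqOn γ (fun t ↦ lieExp (t • (A + ∑ j, c j • Y j)) * g₀ * lieExp (t • B)) (Icc 0 T) := by
  have hγ_int := hγ.isMIntegralCurveOn isOpen_Ioo (Ioo_subset_Icc_self.trans hJ)
    fun t ht ↦ hu t (Ioo_subset_Icc_self ht)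
  rw [rightInvariant_add_mulInvariantVectorField_add_sum] at hγ_int
  simpa only [hγ.initial] using
    eqOn_lieExp_mul_mul_of_isMIntegralCurveOn_Ioo (hγ.continuousOn.mono hJ) hγ_int

end Solutions

section LinearVectorField

variable [LieGroup I ∞ G] {V : (g : G) → TangentSpace I g}

lemma IsLinearVectorField.mdifferentiable (hV : IsLinearVectorField V) : MDiff (T% V) :=
  hV.smooth.mdifferentiable (by simp)

lemma IsLinearVectorField.apply_mul (hV : IsLinearVectorField V) (g h : G) :
    V (g * h) = mfderiv I I (fun x ↦ x * h) g (V g) + mfderiv I I (fun x ↦ g * x) h (V h) := by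
  obtain ⟨φ, hφ, -, -⟩ := hV.exists_flow
  have hmul : (fun t ↦ φ t (g * h)) = fun t ↦ φ t g * φ t h :=
    funext fun t ↦ map_mul (φ t) g h
  have hgh := hφ.isMIntegralCurve (g * h) 0
  rw [hmul] at hgh
  have hvel : (V (φ 0 g * φ 0 h) : E) = mfderiv I I (fun x ↦ x * φ 0 h) (φ 0 g) (V (φ 0 g)) +
      mfderiv I I (fun x ↦ φ 0 g * x) (φ 0 h) (V (φ 0 h)) := velocity_unique hgh
    (hasMFDerivAt_mul_curve (hφ.isMIntegralCurve g 0) (hφ.isMIntegralCurve h 0))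
  rwa [hφ.map_zero, hφ.map_zero] at hvel

lemma IsLinearVectorField.apply_one (hV : IsLinearVectorField V) : V 1 = 0 := by
  have h : (V (1 * 1) : E) = mfderiv I I (fun x ↦ x * 1) 1 (V 1) +
    mfderiv I I (fun x ↦ 1 * x) 1 (V 1) := hV.apply_mul 1 1
  have hR : (mfderiv I I (fun x : G ↦ x * 1) 1 (V 1) : E) = V 1 := rightInvariant_one (V 1)
  have hL : (mfderiv I I (fun x : G ↦ 1 * x) 1 (V 1) : E) = V 1 := mulInvariantVectorField_one (V 1)
  rw [hR, hL, mul_one] at h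
  exact left_eq_add.1 h

lemma IsLinearVectorField.mfderiv_mul_right (hV : IsLinearVectorField V) (g h : G) :
    mfderiv I I (fun x ↦ x * h) g (V g) =
      (V + mulInvariantVectorField (-leftCoeff V h)) (g * h) := by
  have hneg : mulInvariantVectorField (-leftCoeff V h) (g * h) =
    -mulInvariantVectorField (leftCoeff V h) (g * h) := map_neg _ (leftCoeff V h)
  rw [Pi.add_apply, hneg, eq_add_neg_iff_add_eq, ← mfderiv_mul_left_mulInvariantVectorField,
    mulInvariantVectorField_leftCoeff]
  exact (hV.apply_mul g h).symm

variable [I.Boundaryless] [T2Space G] [CompleteSpace E]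

lemma IsLinearVectorField.mlieBracket_rightInvariant (hV : IsLinearVectorField V)
    (Y : GroupLieAlgebra I G) :
    mlieBracket I V (rightInvariant Y) = rightInvariant (mlieBracket I V (rightInvariant Y) 1) := by
  ext h
  let L : (g : G) → TangentSpace I g := mulInvariantVectorField (-leftCoeff V h)
  have hL : MDiff (T% L) := mdifferentiable_mulInvariantVectorField _
  have hVL : MDiff (T% (V + L)) :=
    fun g ↦ mdifferentiableAt_add_section (hV.mdifferentiable g) (hL g)
  have hpush := mfderiv_mlieBracket_of_related (rightTranslation (I := I) h)
    (fun g ↦ hV.mfderiv_mul_right g h) (mfderiv_mul_right_rightInvariant h Y)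
    hVL (mdifferentiable_rightInvariant Y) 1
  rw [mlieBracket_add_left (hV.mdifferentiable _) (hL _),
    mlieBracket_mulInvariantVectorField_rightInvariant, Pi.zero_apply, add_zero] at hpush
  have hone : rightTranslation (I := I) h 1 = h := one_mul h
  rw [hone] at hpush
  exact hpush.symm

/-- The derivation `Y ↦ [V, Y]` of the Lie algebra of the group given by a linear vector field `V`,
where `Y` is read as a right-invariant field; it is the opposite of the derivation associated to
`V`. -/
noncomputable def bracketDerivation (hV : IsLinearVectorField V) :
    LieDerivation ℝ (GroupLieAlgebra I G) (GroupLieAlgebra I G) where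
  toFun Y := mlieBracket I V (rightInvariant Y) 1
  map_add' Y Y' := by
    rw [rightInvariant_add, mlieBracket_add_right (mdifferentiable_rightInvariant Y 1)
      (mdifferentiable_rightInvariant Y' 1)]
  map_smul' c Y := by
    rw [rightInvariant_smul, mlieBracket_const_smul_right (mdifferentiable_rightInvariant Y 1)]
    rfl
  leibniz' Y Z := by
    have hle : minSmoothness ℝ 2 ≤ ∞ := by simpa using ENat.LEInfty.out
    have hjacobi := leibniz_identity_mlieBracket (hV.smooth.of_le hle)
      ((contMDiff_rightInvariant Y).of_le hle) ((contMDiff_rightInvariant Z).of_le hle)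
    rw [LinearControl.mlieBracket_rightInvariant, hV.mlieBracket_rightInvariant Y,
      hV.mlieBracket_rightInvariant Z, LinearControl.mlieBracket_rightInvariant,
      LinearControl.mlieBracket_rightInvariant, ← rightInvariant_add,
      ← neg_one_smul ℝ, rightInvariant_smul] at hjacobi
    have hone := congrFun hjacobi 1
    rw [mlieBracket_const_smul_right (mdifferentiable_rightInvariant _ 1), rightInvariant_one,
      neg_one_smul, ← neg_add, neg_inj] at hone
    change mlieBracket I V (rightInvariant ⁅Y, Z⁆) 1 =
      ⁅Y, mlieBracket I V (rightInvariant Z) 1⁆ - ⁅Z, mlieBracket I V (rightInvariant Y) 1⁆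
    rw [hone, ← lie_skew Z, sub_neg_eq_add, add_comm]

end LinearVectorField

section InnerDerivation

variable [LieGroup I ∞ G] {V : (g : G) → TangentSpace I g}

lemma IsInnerBy.mlieBracket_add_rightInvariant_neg [CompleteSpace E] (hV : MDiff (T% V))
    {X : GroupLieAlgebra I G} (hX : IsInnerBy V X) (Y : GroupLieAlgebra I G) :
    mlieBracket I (V + rightInvariant (-X)) (rightInvariant Y) = 0 := by
  have hXY : mlieBracket I V (rightInvariant Y) =
    mlieBracket I (rightInvariant X) (rightInvariant Y) := neg_injective (hX Y)
  ext g
  rw [mlieBracket_add_left (hV g) (mdifferentiable_rightInvariant _ g), hXY,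
    ← mlieBracket_add_left (mdifferentiable_rightInvariant _ g)
      (mdifferentiable_rightInvariant _ g), ← rightInvariant_add, add_neg_cancel,
    rightInvariant_zero, mlieBracket_zero_left]

variable [I.Boundaryless] [T2Space G] [FiniteDimensional ℝ E]

lemma IsLinearVectorField.exists_isInnerBy [LieAlgebra.HasTrivialRadical ℝ (GroupLieAlgebra I G)]
    (hV : IsLinearVectorField V) : ∃ X : GroupLieAlgebra I G, IsInnerBy V X := by
  have : CompleteSpace E := FiniteDimensional.complete ℝ E
  have : Module.Finite ℝ (GroupLieAlgebra I G) := inferInstanceAs (Module.Finite ℝ E)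
  obtain ⟨X, hX⟩ := LieDerivation.IsKilling.exists_eq_ad (bracketDerivation hV)
  refine ⟨-X, fun Y ↦ ?_⟩
  have hY : mlieBracket I V (rightInvariant Y) 1 = ⁅X, Y⁆ :=
    (LieDerivation.congr_fun hX Y).symm.trans (LieDerivation.ad_apply_apply ℝ _ X Y)
  rw [derivationOf, hV.mlieBracket_rightInvariant, hY, LinearControl.mlieBracket_rightInvariant,
    neg_lie, neg_neg]

lemma IsInnerBy.eq_rightInvariant_add_mulInvariantVectorField [ConnectedSpace G]
    {X : GroupLieAlgebra I G} (hX : IsInnerBy V X) (hV : IsLinearVectorField V) :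
    V = rightInvariant X + mulInvariantVectorField (-X) := by
  have hleft : V + rightInvariant (-X) = mulInvariantVectorField (-X) := by
    have hone : (V + rightInvariant (-X) : (g : G) → TangentSpace I g) 1 = (-X : E) := by
      rw [Pi.add_apply, hV.apply_one, rightInvariant_one, zero_add]
    have h := eq_mulInvariantVectorField_of_commute
      (hV.smooth.add_section (contMDiff_rightInvariant (-X))) fun Y ↦ by
        rw [mlieBracket_swap]
        exact (congrArg Neg.neg (hX.mlieBracket_add_rightInvariant_neg hV.mdifferentiable Y)).trans
          neg_zero
    rwa [hone] at h
  rw [← hleft, add_left_comm, ← rightInvariant_add, add_neg_cancel, rightInvariant_zero, add_zero]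

end InnerDerivation

end LinearControl

theorem theorem5p1 {E : Type*} [NormedAddCommGroup E] [NormedSpace ℝ E] [FiniteDimensional ℝ E]
    {H : Type*} [TopologicalSpace H] (I : ModelWithCorners ℝ E H) [I.Boundaryless]
    {G : Type*} [TopologicalSpace G] [ChartedSpace H G] [Group G] [LieGroup I ∞ G]
    [T2Space G] [ConnectedSpace G]
    (𝒳 : (g : G) → TangentSpace I g) (h𝒳 : LinearControl.IsLinearVectorField 𝒳) :
    (∀ X : GroupLieAlgebra I G, LinearControl.IsInnerBy 𝒳 X →
      𝒳 = LinearControl.rightInvariant X +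
          LinearControl.inversionField (LinearControl.rightInvariant X) ∧
      (∀ φ : ℝ → G → G, LinearControl.IsFlow 𝒳 φ → ∀ (t : ℝ) (g : G),
        φ t g = LinearControl.lieExp (t • X) * g * LinearControl.lieExp (-(t • X))) ∧
      ∀ (m : ℕ) (Y : Fin m → GroupLieAlgebra I G) (u : ℝ → Fin m → ℝ),
        LinearControl.IsPiecewiseConstant u →
        ∀ (T : ℝ), 0 ≤ T → ∀ c : Fin m → ℝ, (∀ t ∈ Set.Icc 0 T, u t = c) →
          LinearControl.IsSolutionOn 𝒳 Y u 1
            (fun t => LinearControl.lieExp (t • X + ∑ j, (t * c j) • Y j) *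
              LinearControl.lieExp (-(t • X))) (Set.Icc 0 T) ∧
          ∀ (J : Set ℝ), J.OrdConnected → Set.Icc 0 T ⊆ J →
            ∀ γ : ℝ → G, LinearControl.IsSolutionOn 𝒳 Y u 1 γ J →
              ∀ t ∈ Set.Icc 0 T,
                γ t = LinearControl.lieExp (t • X + ∑ j, (t * c j) • Y j) *
                  LinearControl.lieExp (-(t • X))) ∧
    (LieAlgebra.HasTrivialRadical ℝ (GroupLieAlgebra I G) →
      ∃ X : GroupLieAlgebra I G, LinearControl.IsInnerBy 𝒳 X) := by
  have : CompleteSpace E := FiniteDimensional.complete ℝ E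
  refine ⟨fun X hX ↦ ?_, fun _ ↦ h𝒳.exists_isInnerBy⟩
  have hfield := hX.eq_rightInvariant_add_mulInvariantVectorField h𝒳
  refine ⟨by rw [LinearControl.inversionField_rightInvariant, ← hfield], fun φ hφ t g ↦ ?_,
    fun m Y u _ T _ c hu ↦ ?_⟩
  · have h := LinearControl.eq_lieExp_mul_mul_of_isMIntegralCurve
      (hfield ▸ hφ.isMIntegralCurve g) t
    rwa [hφ.map_zero, smul_neg] at h
  · have hcurve (t : ℝ) : (LinearControl.lieExp (t • X + ∑ j, (t * c j) • Y j) : G) *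
        LinearControl.lieExp (-(t • X)) =
          LinearControl.lieExp (t • (X + ∑ j, c j • Y j)) * 1 *
            LinearControl.lieExp (t • (-X)) := by
      simp only [smul_add, Finset.smul_sum, smul_smul, smul_neg, mul_one]
    simp only [hcurve]
    rw [hfield]
    exact ⟨LinearControl.isSolutionOn_lieExp_mul_mul hu 1,
      fun J _ hJ γ hγ ↦ hγ.eqOn_lieExp_mul_mul hJ hu⟩
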